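/- Let $n\ge 4$, and let $A[D_n]$ be the Artin group of type $D_n$, that is, the group with generators $t_1,\dots,t_n$ and relations $t_it_jt_i=t_jt_it_j$ if $\{i,j\}=\{k,k+1\}$ for some $1\le k\le n-2$ or $\{i,j\}=\{n-2,n\}$, and $t_it_j=t_jt_i$ for all other pairs $i\ne j$. Let $Z(A[D_n])$ be its center. Then every endomorphism $\psi$ of $A[D_n]/Z(A[D_n])$ lifts to an endomorphism of $A[D_n]$: there is an endomorphism $\varphi$ of $A[D_n]$ such that $\varphi(Z(A[D_n]))\subseteq Z(A[D_n])$ and the endomorphism of $A[D_n]/Z(A[D_n])$ induced by $\varphi$ is $\psi$. -/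

import Mathlib

/-- The oriented edges of the Coxeter graph `D_n`, with vertices numbered `0, …, n - 1`
(vertex `k` stands for the generator `t_{k+1}`): the path `0 — 1 — ⋯ — (n - 2)`, and one further
edge joining `n - 3` to `n - 1`. -/
def DynkinDEdge (n a b : ℕ) : Prop :=
  (a + 1 = b ∧ b + 1 < n) ∨ (a + 3 = n ∧ b + 1 = n)

instance (n a b : ℕ) : Decidable (DynkinDEdge n a b) :=
  inferInstanceAs (Decidable ((a + 1 = b ∧ b + 1 < n) ∨ (a + 3 = n ∧ b + 1 = n)))

/-- The Coxeter matrix of type `D_n`: `m i j = 3` if `i` and `j` are joined by an edge of the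
Coxeter graph `D_n`, and `m i j = 2` for distinct `i`, `j` that are not joined.
Mathlib's `CoxeterMatrix.D` is not used, since it also has an entry `3` at the two end vertices
`n - 2`, `n - 1` of the fork, which commute in type `D_n`. -/
def coxeterMatrixD (n : ℕ) : CoxeterMatrix (Fin n) where
  M := Matrix.of fun i j : Fin n =>
    if i = j then 1 else if DynkinDEdge n i j ∨ DynkinDEdge n j i then 3 else 2
  isSymm := by
    ext i j
    simp only [Matrix.transpose_apply, Matrix.of_apply, eq_comm (a := j) (b := i),
      or_comm (a := DynkinDEdge n j i)]
  diagonal i := by simp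
  off_diagonal i j h := by
    simp only [Matrix.of_apply, if_neg h]
    split_ifs <;> decide

/-- The Artin relators of a Coxeter matrix `M`: for all `i`, `j`, the alternating products
`⋯ s_i s_j` and `⋯ s_j s_i` with `M i j` factors are equal. For `i = j` this is void, as it is
for `M i j = 0`, which encodes `∞`. -/
def artinRelators {B : Type*} (M : CoxeterMatrix B) : Set (FreeGroup B) :=
  {r | ∃ i j : B,
    r = ((CoxeterSystem.alternatingWord i j (M i j)).map FreeGroup.of).prod *
      (((CoxeterSystem.alternatingWord j i (M i j)).map FreeGroup.of).prod)⁻¹}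

/-- The Artin group of a Coxeter matrix. -/
abbrev ArtinGroup {B : Type*} (M : CoxeterMatrix B) : Type _ :=
  PresentedGroup (artinRelators M)

/-- The Artin group `A[D_n]` of type `D_n`. -/
abbrev ArtinD (n : ℕ) : Type := ArtinGroup (coxeterMatrixD n)

/-- The quotient `G / Z(G)` of a group by its center. -/
abbrev ModCenter (G : Type*) [Group G] : Type _ := G ⧸ Subgroup.center G

/-- `φ` is a lift of `ψ`: the endomorphism `φ` of `G` maps the center of `G` into itself, and
the endomorphism of `G / Z(G)` induced by `φ` is `ψ`. -/
def IsLiftModCenter {G : Type*} [Group G] (φ : G →* G) (ψ : ModCenter G →* ModCenter G) : Prop :=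
  ∃ h : Subgroup.center G ≤ (Subgroup.center G).comap φ,
    QuotientGroup.map (Subgroup.center G) (Subgroup.center G) φ h = ψ

/-! Write `G` for the Artin group and `Z` for its center. To lift `ψ` it is enough to choose
preimages in `G` of the `ψ`-images of the generators so that the defining relations hold in `G`, not
just modulo `Z`.

If `x * y * x = y * x * y` modulo `Z`, the two sides differ by a central factor `c`, and replacing
`y` by `y * c` multiplies them by `c` and `c ^ 2` respectively, which repairs the relation
(`exists_braid_lift`). The Coxeter graph is a tree, so these corrections can be made edge by edge
without conflict. If `x` and `y` commute modulo `Z`, their commutator is central and independent of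
the chosen lifts. Any two commuting generators are interchanged by a conjugation, through the
Garside element of an `A₃` subgraph; hence the commutator equals its inverse
(`commute_of_swappable_mod_center`), and it is trivial once `Z` has no element of order two.

For this last point, `G` embeds in a semidirect product of a free group and a braid group (Crisp and
Paris). The braid component of a central element is a central braid, hence pure, and the free
component lies in a torsion-free group. That pure braids have no element of order two
(`Braid.eq_one_of_sq_eq_one`) follows by induction on the number of strands: a braid fixing the
position of the initial strand comes from a free group extended by the braid group of the other
strands. -/

/-! ### Braid groups and their generators. -/

/-- The relations of the braid group on `m + 1` strands, for a sequence of elements of a group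
which is trivial from the index `m` on. -/
structure BraidRelations {H : Type*} [Group H] (m : ℕ) (a : ℕ → H) : Prop where
  eq_one : ∀ i, m ≤ i → a i = 1
  braid : ∀ i, i + 1 < m → a i * a (i + 1) * a i = a (i + 1) * a i * a (i + 1)
  comm : ∀ i j, i + 2 ≤ j → a i * a j = a j * a i

/-- The relators of the braid group on `m + 1` strands. -/
def braidRelators (m : ℕ) : Set (FreeGroup ℕ) :=
  {r | (∃ i, m ≤ i ∧ r = .of i) ∨
    (∃ i, i + 1 < m ∧ r = .of i * .of (i + 1) * .of i *
      (.of (i + 1) * .of i * .of (i + 1))⁻¹) ∨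
    ∃ i j, i + 2 ≤ j ∧ r = .of i * .of j * (.of j * .of i)⁻¹}

/-- The braid group on `m + 1` strands, with generators `σ 0, …, σ (m - 1)`; the generators of
index at least `m` are trivial. -/
abbrev Braid (m : ℕ) : Type := PresentedGroup (braidRelators m)

namespace Braid

/-- The standard generators of the braid group. -/
def σ (m i : ℕ) : Braid m := PresentedGroup.of i

theorem relations (m : ℕ) : BraidRelations m (σ m) where
  eq_one i h := PresentedGroup.one_of_mem (Or.inl ⟨i, h, rfl⟩)
  braid i h := PresentedGroup.mk_eq_mk_of_mul_inv_mem (Or.inr (Or.inl ⟨i, h, rfl⟩))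
  comm i j h := PresentedGroup.mk_eq_mk_of_mul_inv_mem (Or.inr (Or.inr ⟨i, j, h, rfl⟩))

section lift
variable {H : Type*} [Group H] {m : ℕ} {a : ℕ → H}

/-- The homomorphism from the braid group determined by images of the generators. -/
def lift (h : BraidRelations m a) : Braid m →* H :=
  PresentedGroup.toGroup (f := a) (by
    rintro r (⟨i, hi, rfl⟩ | ⟨i, hi, rfl⟩ | ⟨i, j, hi, rfl⟩)
    · simpa using h.eq_one i hi
    · simpa only [map_mul, map_inv, mul_inv_eq_one, FreeGroup.lift_apply_of] using h.braid i hi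
    · simpa only [map_mul, map_inv, mul_inv_eq_one, FreeGroup.lift_apply_of] using h.comm i j hi)

@[simp]
theorem lift_σ (h : BraidRelations m a) (i : ℕ) : lift h (σ m i) = a i :=
  PresentedGroup.toGroup.of _

end lift

theorem closure_range_σ (m : ℕ) : Subgroup.closure (Set.range (σ m)) = ⊤ :=
  PresentedGroup.closure_range_of _

end Braid

/-- Cutting off a sequence at the index `m`. -/
def cutoff {H : Type*} [Group H] (m : ℕ) (a : ℕ → H) (i : ℕ) : H := if i < m then a i else 1

theorem cutoff_of_lt {H : Type*} [Group H] {m : ℕ} {a : ℕ → H} {i : ℕ} (h : i < m) :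
    cutoff m a i = a i := if_pos h

theorem cutoff_of_le {H : Type*} [Group H] {m : ℕ} {a : ℕ → H} {i : ℕ} (h : m ≤ i) :
    cutoff m a i = 1 := if_neg (by omega)

theorem BraidRelations.cutoff {H : Type*} [Group H] {m : ℕ} {a : ℕ → H}
    (hb : ∀ i, i + 1 < m → a i * a (i + 1) * a i = a (i + 1) * a i * a (i + 1))
    (hc : ∀ i j, i + 2 ≤ j → j < m → a i * a j = a j * a i) : BraidRelations m (cutoff m a) where
  eq_one i h := cutoff_of_le h
  braid i h := by
    rw [cutoff_of_lt h, cutoff_of_lt (show i < m by omega)]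
    exact hb i h
  comm i j h := by
    by_cases hj : j < m
    · rw [cutoff_of_lt hj, cutoff_of_lt (show i < m by omega)]
      exact hc i j h hj
    · rw [cutoff_of_le (i := j) (by omega)]; simp

/-! ### The permutation representation and Artin's representation. -/

/-- The transpositions of adjacent positions satisfy the braid relations. -/
theorem swap_relations (m : ℕ) :
    BraidRelations m (cutoff m fun i => Equiv.swap i (i + 1)) := by
  refine .cutoff (fun i _ => ?_) (fun i j h _ => ?_) <;> ext k <;>
    simp only [Equiv.Perm.mul_apply, Equiv.swap_apply_def] <;> grind

/-- The permutation of the positions of the strands induced by a braid. -/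
def Braid.perm (m : ℕ) : Braid m →* Equiv.Perm ℕ := Braid.lift (swap_relations m)

theorem Braid.perm_σ {m i : ℕ} (h : i < m) : Braid.perm m (Braid.σ m i) = Equiv.swap i (i + 1) :=
  (Braid.lift_σ _ _).trans (cutoff_of_lt h)

theorem MulAut.freeGroup_ext {α : Type*} {f g : MulAut (FreeGroup α)}
    (h : ∀ k, f (.of k) = g (.of k)) : f = g := by
  have : f.toMonoidHom = g.toMonoidHom := FreeGroup.ext_hom _ _ h
  ext x
  exact DFunLike.congr_fun this x

/-- Artin's automorphism of the free group attached to the `i`-th standard braid generator. -/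
def artinAut (i : ℕ) : MulAut (FreeGroup ℕ) :=
  MonoidHom.toMulEquiv
    (FreeGroup.lift fun k => if k = i then .of (i + 1)
      else if k = i + 1 then (.of (i + 1))⁻¹ * .of i * .of (i + 1) else .of k)
    (FreeGroup.lift fun k => if k = i then .of i * .of (i + 1) * (.of i)⁻¹
      else if k = i + 1 then .of i else .of k)
    (by
      ext k
      by_cases h : k = i
      · simp [h]
      · by_cases h' : k = i + 1 <;> simp [h, h', mul_assoc])
    (by
      ext k
      by_cases h : k = i
      · simp [h, mul_assoc]
      · by_cases h' : k = i + 1 <;> simp [h, h'])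

theorem artinAut_of_self (i : ℕ) : artinAut i (.of i) = .of (i + 1) := by
  simp [artinAut]

theorem artinAut_of_succ (i : ℕ) :
    artinAut i (.of (i + 1)) = (.of (i + 1))⁻¹ * .of i * .of (i + 1) := by
  simp [artinAut]

theorem artinAut_of_ne {i k : ℕ} (h : k ≠ i) (h' : k ≠ i + 1) : artinAut i (.of k) = .of k := by
  simp [artinAut, h, h']

theorem artinAut_relations (m : ℕ) : BraidRelations m (cutoff m artinAut) := by
  refine .cutoff (fun i _ => ?_) (fun i j h _ => ?_) <;> refine MulAut.freeGroup_ext fun k => ?_ <;>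
    simp only [MulAut.mul_apply]
  · by_cases h0 : k = i
    · subst h0
      rw [artinAut_of_self, artinAut_of_self, artinAut_of_ne (i := k) (k := k + 1 + 1),
        artinAut_of_ne (i := k + 1) (k := k), artinAut_of_self, artinAut_of_self] <;> omega
    by_cases h1 : k = i + 1
    · subst h1
      simp only [artinAut_of_self, artinAut_of_succ, map_mul, map_inv,
        artinAut_of_ne (i := i) (k := i + 1 + 1) (by omega) (by omega),
        artinAut_of_ne (i := i + 1) (k := i) (by omega) (by omega)]
    by_cases h2 : k = i + 2
    · subst h2
      have := artinAut_of_succ (i + 1)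
      simp only [add_assoc, Nat.reduceAdd] at this
      simp only [artinAut_of_self, artinAut_of_succ, map_mul, map_inv, this,
        artinAut_of_ne (i := i) (k := i + 2) (by omega) (by omega),
        artinAut_of_ne (i := i + 1) (k := i) (by omega) (by omega)]
      simp [mul_assoc]
    · simp only [artinAut_of_ne (i := i + 1) (k := k) (by omega) (by omega),
        artinAut_of_ne (i := i) (k := k) (by omega) (by omega)]
  · by_cases h0 : k = i ∨ k = i + 1
    · rw [artinAut_of_ne (i := j) (k := k) (by omega) (by omega)]
      rcases h0 with rfl | rfl
      · rw [artinAut_of_self, artinAut_of_ne (by omega) (by omega)]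
      · rw [artinAut_of_succ]
        simp only [map_mul, map_inv]
        rw [artinAut_of_ne (i := j) (k := i) (by omega) (by omega),
          artinAut_of_ne (i := j) (k := i + 1) (by omega) (by omega)]
    · rw [artinAut_of_ne (i := i) (k := k) (by omega) (by omega)]
      by_cases h1 : k = j
      · subst h1
        rw [artinAut_of_self, artinAut_of_ne (by omega) (by omega)]
      by_cases h2 : k = j + 1
      · subst h2
        rw [artinAut_of_succ]
        simp only [map_mul, map_inv]
        rw [artinAut_of_ne (i := i) (k := j) (by omega) (by omega),
          artinAut_of_ne (i := i) (k := j + 1) (by omega) (by omega)]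
      · rw [artinAut_of_ne h1 h2, artinAut_of_ne (by omega) (by omega)]

/-- Artin's representation of the braid group. -/
def Braid.artinRep (m : ℕ) : Braid m →* MulAut (FreeGroup ℕ) := Braid.lift (artinAut_relations m)

theorem Braid.artinRep_σ {m i : ℕ} (h : i < m) : Braid.artinRep m (Braid.σ m i) = artinAut i :=
  (Braid.lift_σ _ _).trans (cutoff_of_lt h)

/-- The relation between two homomorphisms required for a semidirect product `N ⋊[φ] G` with `G`
a braid group needs to be checked on generators only. -/
theorem Braid.conj_compat {m : ℕ} {α H : Type*} [Group H] (φ : Braid m →* MulAut (FreeGroup α))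
    (fn : FreeGroup α →* H) (fg : Braid m →* H)
    (h : ∀ i < m, ∀ k, fn (φ (σ m i) (.of k)) * fg (σ m i) = fg (σ m i) * fn (.of k)) (g : Braid m) :
    fn.comp (φ g).toMonoidHom = (MulAut.conj (fg g)).toMonoidHom.comp fn := by
  have hg : g ∈ Subgroup.closure (Set.range (σ m)) := by rw [closure_range_σ]; trivial
  induction hg using Subgroup.closure_induction with
  | mem x hx =>
    obtain ⟨i, rfl⟩ := hx
    by_cases hi : i < m
    · refine FreeGroup.ext_hom _ _ fun k => ?_
      simpa [eq_mul_inv_iff_mul_eq] using h i hi k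
    · rw [(relations m).eq_one i (by omega)]
      ext; simp
  | one => ext; simp
  | mul x y _ _ hx hy =>
    ext k
    have h1 := DFunLike.congr_fun hx (φ y (.of k))
    have h2 := DFunLike.congr_fun hy (.of k)
    simp only [MonoidHom.comp_apply, MulEquiv.coe_toMonoidHom, MulAut.conj_apply] at h1 h2
    simp [h1, h2, mul_assoc]
  | inv x _ hx =>
    ext k
    have h1 := DFunLike.congr_fun hx ((φ x)⁻¹ (.of k))
    simp only [MonoidHom.comp_apply, MulEquiv.coe_toMonoidHom, MulAut.conj_apply,
      MulAut.apply_inv_self] at h1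
    simp [h1, mul_assoc]

/-! ### Artin's semidirect product. -/

/-- The relations, besides those of the free group and of the braid group, of the semidirect
product of a free group and a braid group given by Artin's representation. -/
structure ArtinRelations {H : Type*} [Group H] (m : ℕ) (s x : ℕ → H) : Prop where
  braid : BraidRelations m s
  comm : ∀ i k, k ≠ i → k + 1 ≠ i → s k * x i = x i * s k
  shift : ∀ i < m, s i * x i = x (i + 1) * s i
  comm_mul : ∀ i < m, s i * (x i * x (i + 1)) = x i * x (i + 1) * s i

/-- The semidirect product of a free group and a braid group given by Artin's representation. -/
abbrev ArtinProduct (m : ℕ) : Type := FreeGroup ℕ ⋊[Braid.artinRep m] Braid m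

namespace ArtinProduct
open SemidirectProduct

theorem conj_inl (m i : ℕ) (h : i < m) (f : FreeGroup ℕ) :
    (inr (Braid.σ m i) * inl f : ArtinProduct m) = inl (artinAut i f) * inr (Braid.σ m i) := by
  rw [← Braid.artinRep_σ h, inl_aut]
  simp [mul_assoc]

theorem relations (m : ℕ) : ArtinRelations m (fun i => (inr (Braid.σ m i) : ArtinProduct m))
    fun i => inl (.of i) where
  braid :=
    { eq_one := fun i h => by simp [(Braid.relations m).eq_one i h]
      braid := fun i h => by simp only [← map_mul, (Braid.relations m).braid i h]
      comm := fun i j h => by simp only [← map_mul, (Braid.relations m).comm i j h] }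
  comm i k h h' := by
    by_cases hk : k < m
    · simp only [conj_inl m k hk, artinAut_of_ne h.symm h'.symm]
    · simp [(Braid.relations m).eq_one k (by omega)]
  shift i h := by simp only [conj_inl m i h, artinAut_of_self]
  comm_mul i h := by
    simp only [← map_mul, conj_inl m i h]
    simp [artinAut_of_self, artinAut_of_succ, mul_assoc]

/-- The homomorphism from the semidirect product determined by images of the generators. -/
def lift {H : Type*} [Group H] {m : ℕ} {s x : ℕ → H} (h : ArtinRelations m s x) :
    ArtinProduct m →* H :=
  SemidirectProduct.lift (FreeGroup.lift x) (Braid.lift h.braid)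
    (Braid.conj_compat _ _ _ fun i hi k => by
      rw [Braid.artinRep_σ hi, Braid.lift_σ, FreeGroup.lift_apply_of]
      by_cases h0 : k = i
      · subst h0
        rw [artinAut_of_self, FreeGroup.lift_apply_of, h.shift k hi]
      by_cases h1 : k = i + 1
      · subst h1
        have h2 := h.comm_mul i hi
        rw [← mul_assoc, h.shift i hi, mul_assoc] at h2
        rw [artinAut_of_succ]
        simp only [map_mul, map_inv, FreeGroup.lift_apply_of]
        rw [mul_assoc, mul_assoc, inv_mul_eq_iff_eq_mul, h2, mul_assoc]
      · rw [artinAut_of_ne h0 h1, FreeGroup.lift_apply_of, h.comm k i (Ne.symm h0) (Ne.symm h1)])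

section lift
variable {H : Type*} [Group H] {m : ℕ} {s x : ℕ → H} (h : ArtinRelations m s x)

@[simp]
theorem lift_inl_of (i : ℕ) : lift h (inl (.of i)) = x i := by simp [lift]

@[simp]
theorem lift_inr (b : Braid m) : lift h (inr b) = Braid.lift h.braid b := by simp [lift]

end lift

end ArtinProduct

/-! ### Coset representatives for the stabilizer of the initial strand. -/

section cosetRep
variable {H : Type*} [Group H] {m : ℕ} {a : ℕ → H}

/-- The product `a (p - 1) * ⋯ * a 0`; for the standard generators of the braid group it moves
the strand at position `0` to position `p`. -/
def cosetRep (a : ℕ → H) : ℕ → H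
  | 0 => 1
  | p + 1 => a p * cosetRep a p

theorem BraidRelations.mul_cosetRep_of_lt (h : BraidRelations m a) {i p : ℕ} (hp : p < i) :
    a i * cosetRep a p = cosetRep a p * a i := by
  induction p with
  | zero => simp [cosetRep]
  | succ p ih =>
    rw [cosetRep, ← mul_assoc, ← h.comm p i (by omega), mul_assoc, ih (by omega), mul_assoc]

theorem BraidRelations.mul_cosetRep_of_gt (h : BraidRelations m a) {i p : ℕ} (hp : i + 2 ≤ p)
    (hi : i + 1 < m) : a i * cosetRep a p = cosetRep a p * a (i + 1) := by
  induction p, hp using Nat.le_induction with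
  | base =>
    rw [cosetRep, cosetRep, mul_assoc, mul_assoc, ← h.mul_cosetRep_of_lt (Nat.lt_succ_self i),
      ← mul_assoc, ← mul_assoc, h.braid i hi, mul_assoc, mul_assoc]
  | succ p hp ih => rw [cosetRep, ← mul_assoc, h.comm i p hp, mul_assoc, ih, mul_assoc]

/-- In the standard braids, the second sequence consists of pure braids in which the initial strand
encircles one other strand, and the shifted generators braid the other strands among themselves. The
commutations come from sliding a generator through `cosetRep`, with an index shift if it lies below
the crossing. -/
theorem BraidRelations.artinRelations (h : BraidRelations (m + 1) a) :
    ArtinRelations m (fun i => a (i + 1))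
      (fun i => (cosetRep a i)⁻¹ * (a i * a i) * cosetRep a i) where
  braid :=
    { eq_one := fun i hi => h.eq_one _ (by omega)
      braid := fun i hi => h.braid _ (by omega)
      comm := fun i j hi => h.comm _ _ (by omega) }
  comm i k hk hk' := by
    change Commute _ _
    rcases Nat.lt_or_ge k i with hki | hki
    · rcases Nat.lt_or_ge k m with hm | hm
      · have h1 : a (k + 1) = (cosetRep a i)⁻¹ * a k * cosetRep a i := by
          rw [mul_assoc, h.mul_cosetRep_of_gt (by omega) (by omega), inv_mul_cancel_left]
        have h2 : Commute (a k) (a i) := h.comm k i (by omega)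
        rw [h1]
        have h3 := congrArg (MulAut.conj (cosetRep a i)⁻¹) (h2.mul_right h2).eq
        simpa [Commute, SemiconjBy, mul_assoc] using h3
      · rw [h.eq_one (k + 1) (by omega)]
        exact Commute.one_left _
    · have h1 : Commute (a (k + 1)) (cosetRep a i) := h.mul_cosetRep_of_lt (by omega)
      have h2 : Commute (a (k + 1)) (a i) := (h.comm i (k + 1) (by omega)).symm
      exact (h1.inv_right.mul_right (h2.mul_right h2)).mul_right h1
  shift i hi := by
    have h1 : Commute (a (i + 1)) (cosetRep a i) := h.mul_cosetRep_of_lt (by omega)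
    have h2 := h.braid i (by omega)
    have h3 : a (i + 1) * (a i * a i) =
        (a i)⁻¹ * (a (i + 1) * a (i + 1)) * a i * a (i + 1) := by
      rw [mul_assoc, mul_assoc, eq_inv_mul_iff_mul_eq]
      calc a i * (a (i + 1) * (a i * a i)) = a i * a (i + 1) * a i * a i := by group
        _ = a (i + 1) * a i * a (i + 1) * a i := by rw [h2]
        _ = a (i + 1) * (a i * a (i + 1) * a i) := by simp only [mul_assoc]
        _ = _ := by rw [h2]; simp only [mul_assoc]
    calc a (i + 1) * ((cosetRep a i)⁻¹ * (a i * a i) * cosetRep a i)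
        = (a (i + 1) * (cosetRep a i)⁻¹) * (a i * a i) * cosetRep a i := by group
      _ = (cosetRep a i)⁻¹ * (a (i + 1) * (a i * a i)) * cosetRep a i := by
        rw [h1.inv_right.eq]; group
      _ = (cosetRep a i)⁻¹ * ((a i)⁻¹ * (a (i + 1) * a (i + 1)) * a i) *
          (a (i + 1) * cosetRep a i) := by rw [h3]; group
      _ = _ := by rw [h1.eq, cosetRep]; group
  comm_mul i hi := by
    have h1 : Commute (a (i + 1)) (cosetRep a i) := h.mul_cosetRep_of_lt (by omega)
    have h2 := h.braid i (by omega)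
    have h3 : Commute (a (i + 1)) (a i * (a (i + 1) * a (i + 1)) * a i) := by
      calc a (i + 1) * (a i * (a (i + 1) * a (i + 1)) * a i)
          = a (i + 1) * a i * a (i + 1) * (a (i + 1) * a i) := by group
        _ = a i * a (i + 1) * (a i * a (i + 1) * a i) := by rw [← h2]; simp only [mul_assoc]
        _ = _ := by rw [h2]; simp only [mul_assoc]
    have h4 : (cosetRep a i)⁻¹ * (a i * a i) * cosetRep a i *
        ((cosetRep a (i + 1))⁻¹ * (a (i + 1) * a (i + 1)) * cosetRep a (i + 1)) =
        (cosetRep a i)⁻¹ * (a i * (a (i + 1) * a (i + 1)) * a i) * cosetRep a i := by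
      rw [cosetRep]; group
    rw [h4]
    exact (h1.inv_right.mul_right h3).mul_right h1

end cosetRep

/-! ### The action obtained by following one strand. -/

section strandAction
variable {K : Type*} [Group K]

/-- The permutation of `ℕ × K` by which the `i`-th braid generator on `m + 2` strands acts: the
first component is the position of the strand at issue, and the second one records the braid
formed by the other strands, together with their linking with the strand at issue. -/
def strandPerm (m : ℕ) (s x : ℕ → K) (i : ℕ) : Equiv.Perm (ℕ × K) :=
  Equiv.prodShear (Equiv.swap i (i + 1)) fun p => Equiv.mulLeft <|
    if p < i then s (i - 1) else if p = i then 1 else if p = i + 1 then x i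
    else if p ≤ m + 1 then s i else 1

variable {m : ℕ} {s x : ℕ → K}

theorem strandPerm_fst (i : ℕ) (y : ℕ × K) :
    (strandPerm m s x i y).1 = Equiv.swap i (i + 1) y.1 := rfl

theorem strandPerm_of_lt {i p : ℕ} (h : p < i) (k : K) :
    strandPerm m s x i (p, k) = (p, s (i - 1) * k) := by
  simp [strandPerm, Equiv.prodShear, h, Equiv.swap_apply_of_ne_of_ne (show p ≠ i by omega)
    (show p ≠ i + 1 by omega)]

theorem strandPerm_self (i : ℕ) (k : K) : strandPerm m s x i (i, k) = (i + 1, k) := by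
  simp [strandPerm, Equiv.prodShear]

theorem strandPerm_succ (i : ℕ) (k : K) : strandPerm m s x i (i + 1, k) = (i, x i * k) := by
  simp [strandPerm, Equiv.prodShear]

theorem strandPerm_of_gt {i p : ℕ} (h : i + 1 < p) (hp : p ≤ m + 1) (k : K) :
    strandPerm m s x i (p, k) = (p, s i * k) := by
  simp [strandPerm, Equiv.prodShear, show ¬ p < i by omega, show p ≠ i by omega,
    show p ≠ i + 1 by omega, hp, Equiv.swap_apply_of_ne_of_ne (show p ≠ i by omega)
    (show p ≠ i + 1 by omega)]

theorem strandPerm_of_gt' {i p : ℕ} (h : i + 1 < p) (hp : ¬ p ≤ m + 1) (k : K) :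
    strandPerm m s x i (p, k) = (p, k) := by
  simp [strandPerm, Equiv.prodShear, show ¬ p < i by omega, show p ≠ i by omega,
    show p ≠ i + 1 by omega, hp, Equiv.swap_apply_of_ne_of_ne (show p ≠ i by omega)
    (show p ≠ i + 1 by omega)]

/-- If the followed strand takes no part in the three crossings, this is a braid relation for the
other strands, with indices lowered by one if that strand lies to the left. Starting at `i` the two
sides agree outright; starting at `i + 1` they agree by `shift`, and at `i + 2` by `comm_mul`. -/
theorem ArtinRelations.strandPerm_braid (h : ArtinRelations m s x) {i : ℕ} (hi : i < m) :
    strandPerm m s x i * strandPerm m s x (i + 1) * strandPerm m s x i =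
      strandPerm m s x (i + 1) * strandPerm m s x i * strandPerm m s x (i + 1) := by
  refine Equiv.ext fun ⟨p, k⟩ => ?_
  simp only [Equiv.Perm.mul_apply]
  rcases lt_trichotomy p i with hp | rfl | hp
  · obtain ⟨i, rfl⟩ : ∃ j, i = j + 1 := ⟨i - 1, by omega⟩
    have := h.braid.braid i hi
    simp only [strandPerm_of_lt hp, strandPerm_of_lt (show p < i + 1 + 1 by omega),
      Nat.add_sub_cancel, ← mul_assoc, this]
  · simp only [strandPerm_self, strandPerm_of_gt (show p + 1 < p + 1 + 1 by omega)
      (show p + 1 + 1 ≤ m + 1 by omega), strandPerm_of_lt (show p < p + 1 by omega), Nat.add_sub_cancel]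
  rcases lt_trichotomy p (i + 2) with hp' | rfl | hp'
  · obtain rfl : p = i + 1 := by omega
    have := h.shift i hi
    simp only [strandPerm_self, strandPerm_succ, strandPerm_of_gt (show i + 1 < i + 1 + 1 by omega)
      (show i + 1 + 1 ≤ m + 1 by omega), strandPerm_of_lt (show i < i + 1 by omega), Nat.add_sub_cancel,
      ← mul_assoc, this]
  · have := h.comm_mul i hi
    rw [strandPerm_of_gt (p := i + 2) (by omega) (by omega)]
    have h1 : ∀ k : K, strandPerm m s x (i + 1) (i + 2, k) = (i + 1, x (i + 1) * k) :=
      strandPerm_succ (i + 1)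
    simp only [h1, strandPerm_succ, strandPerm_of_lt (show i < i + 1 by omega), Nat.add_sub_cancel,
      ← mul_assoc] at this ⊢
    rw [this]
  -- A position in range forces `i + 1 < m`, where the braid relation for `s` is available. It can
  -- fail for `i + 1 = m`, as `s m = 1`; hence the trivial factor in `strandPerm` at positions out
  -- of range.
  · by_cases hm : p ≤ m + 1
    · simp only [strandPerm_of_gt (show i + 1 < p by omega) hm,
        strandPerm_of_gt (show i + 1 + 1 < p by omega) hm, ← mul_assoc,
        h.braid.braid i (by omega)]
    · simp only [strandPerm_of_gt' (show i + 1 < p by omega) hm,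
        strandPerm_of_gt' (show i + 1 + 1 < p by omega) hm]

theorem ArtinRelations.strandPerm_comm (h : ArtinRelations m s x) {i j : ℕ} (hij : i + 2 ≤ j)
    (hj : j < m + 1) :
    strandPerm m s x i * strandPerm m s x j = strandPerm m s x j * strandPerm m s x i := by
  refine Equiv.ext fun ⟨p, k⟩ => ?_
  simp only [Equiv.Perm.mul_apply]
  rcases lt_trichotomy p i with hp | rfl | hp
  · simp only [strandPerm_of_lt hp, strandPerm_of_lt (show p < j by omega), ← mul_assoc,
      h.braid.comm (i - 1) (j - 1) (by omega)]
  · simp only [strandPerm_self, strandPerm_of_lt (show p < j by omega),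
      strandPerm_of_lt (show p + 1 < j by omega)]
  rcases lt_trichotomy p (i + 1) with hp' | rfl | hp'
  · omega
  · simp only [strandPerm_succ, strandPerm_of_lt (show i < j by omega),
      strandPerm_of_lt (show i + 1 < j by omega), ← mul_assoc,
      h.comm i (j - 1) (by omega) (by omega)]
  rcases lt_trichotomy p j with hpj | rfl | hpj
  · simp only [strandPerm_of_gt hp' (show p ≤ m + 1 by omega), strandPerm_of_lt hpj, ← mul_assoc,
      h.braid.comm i (j - 1) (by omega)]
  · simp only [strandPerm_self, strandPerm_of_gt hp' (show p ≤ m + 1 by omega),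
      strandPerm_of_gt (show i + 1 < p + 1 by omega) (show p + 1 ≤ m + 1 by omega)]
  rcases lt_trichotomy p (j + 1) with hpj' | rfl | hpj'
  · omega
  · simp only [strandPerm_succ, strandPerm_of_gt hp' (show j + 1 ≤ m + 1 by omega),
      strandPerm_of_gt (show i + 1 < j by omega) (show j ≤ m + 1 by omega), ← mul_assoc,
      h.comm j i (by omega) (by omega)]
  · by_cases hm : p ≤ m + 1
    · simp only [strandPerm_of_gt hp' hm, strandPerm_of_gt hpj' hm, ← mul_assoc,
        h.braid.comm i j hij]
    · simp only [strandPerm_of_gt' hp' hm, strandPerm_of_gt' hpj' hm]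

theorem ArtinRelations.strandPerm_relations (h : ArtinRelations m s x) :
    BraidRelations (m + 1) (cutoff (m + 1) (strandPerm m s x)) :=
  .cutoff (fun _ hi => h.strandPerm_braid (by omega)) fun _ _ hij hj => h.strandPerm_comm hij hj

end strandAction

/-! ### Absence of elements of order two in pure braid groups. -/

namespace Braid

/-- To prove a property of all braids, it suffices to prove it for the generators and to show that
it is inherited by products and inverses. -/
theorem induction {m : ℕ} {C : Braid m → Prop} (one : C 1) (gen : ∀ i < m, C (σ m i))
    (mul : ∀ a b, C a → C b → C (a * b)) (inv : ∀ a, C a → C a⁻¹) (b : Braid m) : C b := by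
  have hb : b ∈ Subgroup.closure (Set.range (σ m)) := by rw [closure_range_σ]; trivial
  induction hb using Subgroup.closure_induction with
  | mem y hy =>
    obtain ⟨i, rfl⟩ := hy
    by_cases hi : i < m
    · exact gen i hi
    · rwa [(relations m).eq_one i (by omega)]
  | one => exact one
  | mul a b _ _ ha hb => exact mul a b ha hb
  | inv a _ ha => exact inv a ha

theorem perm_apply_of_lt {m : ℕ} (b : Braid m) {p : ℕ} (hp : m < p) : perm m b p = p := by
  induction b using Braid.induction with
  | one => simp
  | gen i hi => rw [perm_σ hi, Equiv.swap_apply_of_ne_of_ne] <;> omega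
  | mul a b ha hb => rw [map_mul, Equiv.Perm.mul_apply, hb, ha]
  | inv a ha => rw [map_inv, Equiv.Perm.inv_eq_iff_eq, ha]

theorem perm_apply_le {m : ℕ} (b : Braid m) {p : ℕ} (hp : p ≤ m) : perm m b p ≤ m := by
  by_contra! h
  have := (perm m b).injective (perm_apply_of_lt b h)
  omega

/-- The action of the braid group on `m + 2` strands on `ℕ × ArtinProduct m`. -/
def strandAction (m : ℕ) : Braid (m + 1) →* Equiv.Perm (ℕ × ArtinProduct m) :=
  lift (ArtinProduct.relations m).strandPerm_relations

theorem strandAction_σ {m i : ℕ} (h : i < m + 1) : strandAction m (σ (m + 1) i) =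
    strandPerm m (fun i => SemidirectProduct.inr (σ m i))
      (fun i => SemidirectProduct.inl (.of i)) i :=
  (lift_σ _ _).trans (cutoff_of_lt h)

theorem strandAction_fst {m : ℕ} (b : Braid (m + 1)) (y : ℕ × ArtinProduct m) :
    (strandAction m b y).1 = perm (m + 1) b y.1 := by
  induction b using Braid.induction generalizing y with
  | one => simp
  | gen i hi => rw [strandAction_σ hi, perm_σ hi, strandPerm_fst]
  | mul a b ha hb => simp [ha, hb]
  | inv a ha =>
    rw [map_inv, map_inv, Equiv.Perm.eq_inv_iff_eq, ← ha, ← Equiv.Perm.mul_apply, mul_inv_cancel,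
      Equiv.Perm.one_apply]

/-- Generators act on the second component by left multiplications, which commute with right
multiplication by `k`. -/
theorem strandAction_snd {m : ℕ} (b : Braid (m + 1)) (p : ℕ) (k : ArtinProduct m) :
    (strandAction m b (p, k)).2 = (strandAction m b (p, 1)).2 * k := by
  induction b using Braid.induction generalizing p k with
  | one => simp
  | gen i hi => simp [strandAction_σ hi, strandPerm, Equiv.prodShear]
  | mul a b ha hb =>
    have key (k) : strandAction m b (p, k) = (perm (m + 1) b p, (strandAction m b (p, 1)).2 * k) :=
      Prod.ext (strandAction_fst b _) (hb p k)
    rw [map_mul, Equiv.Perm.mul_apply, Equiv.Perm.mul_apply, key, ha, key 1, ha _ (_ * 1)]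
    simp [mul_assoc]
  | inv a ha =>
    have h1 := strandAction_fst a⁻¹ (p, k)
    have h2 := strandAction_fst a⁻¹ (p, 1)
    have key (y : ArtinProduct m) :
        (strandAction m a ((perm (m + 1) a⁻¹ p), 1)).2 * (strandAction m a⁻¹ (p, y)).2 = y := by
      rw [← ha, ← strandAction_fst a⁻¹ (p, y)]
      simp
    have h3 := (congrArg (· * k) (key 1)).trans ((one_mul k).trans (key k).symm)
    simpa [mul_assoc] using h3.symm

/-- The homomorphism from the stabilizer of the initial strand to the braid group. -/
def ofArtinProduct (m : ℕ) : ArtinProduct m →* Braid (m + 1) :=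
  ArtinProduct.lift (relations (m + 1)).artinRelations

/-- A braid is recovered from its action. -/
theorem strandAction_equivariant {m : ℕ} (b : Braid (m + 1)) (p : ℕ) (hp : p ≤ m + 1)
    (k : ArtinProduct m) :
    cosetRep (σ (m + 1)) (strandAction m b (p, k)).1 *
      ofArtinProduct m (strandAction m b (p, k)).2 =
      b * (cosetRep (σ (m + 1)) p * ofArtinProduct m k) := by
  -- The map `(p, k) ↦ cosetRep p * ofArtinProduct k` intertwines the action with left
  -- multiplication, so only generators need a computation.
  induction b using Braid.induction generalizing p k with
  | one => simp
  | gen i hi =>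
    rw [strandAction_σ hi]
    have hr := relations (m + 1)
    rcases lt_trichotomy p i with h | rfl | h
    · rw [strandPerm_of_lt h]
      simp only [map_mul, ofArtinProduct, ArtinProduct.lift_inr, lift_σ, ← mul_assoc]
      rw [show i - 1 + 1 = i by omega, hr.mul_cosetRep_of_lt h]
    · rw [strandPerm_self, cosetRep, mul_assoc]
    rcases lt_trichotomy p (i + 1) with h' | rfl | h'
    · omega
    · rw [strandPerm_succ]
      simp only [map_mul, ofArtinProduct, ArtinProduct.lift_inl_of, cosetRep]
      group
    · rw [strandPerm_of_gt h' hp]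
      simp only [map_mul, ofArtinProduct, ArtinProduct.lift_inr, lift_σ, ← mul_assoc]
      rw [hr.mul_cosetRep_of_gt h' (by omega)]
  | mul a b ha hb =>
    rw [map_mul, Equiv.Perm.mul_apply, mul_assoc, ← hb p hp k]
    exact ha _ ((strandAction_fst b (p, k)).trans_le (perm_apply_le b hp)) _
  | inv a ha =>
    have h1 := ha _ ((strandAction_fst a⁻¹ (p, k)).trans_le (perm_apply_le a⁻¹ hp))
      (strandAction m a⁻¹ (p, k)).2
    rw [Prod.mk.eta, map_inv, ← Equiv.Perm.mul_apply, mul_inv_cancel, Equiv.Perm.one_apply] at h1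
    rw [h1, map_inv, inv_mul_cancel_left]

theorem perm_conj_sq {m : ℕ} (r : Braid m) (i : ℕ) : perm m (r⁻¹ * (σ m i * σ m i) * r) = 1 := by
  by_cases hi : i < m
  · simp [perm_σ hi]
  · simp [(relations m).eq_one i (by omega)]

theorem perm_ofArtinProduct_inl {m : ℕ} (f : FreeGroup ℕ) :
    perm (m + 1) (ofArtinProduct m (SemidirectProduct.inl f)) = 1 := by
  have : ((perm (m + 1)).comp (ofArtinProduct m)).comp SemidirectProduct.inl = 1 := by
    refine FreeGroup.ext_hom _ _ fun i => ?_
    simpa [ofArtinProduct, mul_assoc] using perm_conj_sq (cosetRep (σ (m + 1)) i) i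
  exact DFunLike.congr_fun this f

theorem perm_ofArtinProduct_inr {m : ℕ} (b : Braid m) (p : ℕ) :
    perm (m + 1) (ofArtinProduct m (SemidirectProduct.inr b)) (p + 1) = perm m b p + 1 := by
  induction b using Braid.induction generalizing p with
  | one => simp
  | gen i hi =>
    simp only [ofArtinProduct, ArtinProduct.lift_inr, lift_σ]
    rw [perm_σ hi, perm_σ (Nat.succ_lt_succ hi)]
    simp only [Equiv.swap_apply_def]
    grind
  | mul a b ha hb => simp [ha, hb]
  | inv a ha =>
    simp only [map_inv]
    rw [Equiv.Perm.inv_eq_iff_eq, ha, ← Equiv.Perm.mul_apply, mul_inv_cancel,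
      Equiv.Perm.one_apply]

/-- The pure braid group has no element of order two. -/
theorem eq_one_of_sq_eq_one {m : ℕ} (b : Braid m) (hp : perm m b = 1) (hb : b ^ 2 = 1) :
    b = 1 := by
  induction m with
  | zero =>
    clear hp hb
    induction b using Braid.induction <;> simp_all
  | succ m ih =>
    set k := (strandAction m b (0, 1)).2 with hk
    have h0 (y) : strandAction m b (0, y) = (0, k * y) :=
      Prod.ext (by rw [strandAction_fst, hp]; rfl) (strandAction_snd b 0 y)
    -- Equivariance at position `0`, where `cosetRep` is trivial. Injectivity of `ofArtinProduct` is
    -- never needed: `k * k = 1` is read off from the action.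
    have hbk : b = ofArtinProduct m k := by
      simpa [h0, cosetRep] using (strandAction_equivariant b 0 (Nat.zero_le _) 1).symm
    have hkk : k * k = 1 := by
      have h1 : strandAction m (b ^ 2) (0, 1) = (0, k * k) := by
        rw [pow_two, map_mul, Equiv.Perm.mul_apply, h0, h0]; simp
      rw [hb] at h1
      simpa using h1.symm
    have hr : k.right = 1 := by
      refine ih _ ?_ (by simpa [pow_two] using congrArg SemidirectProduct.right hkk)
      -- The free part maps to pure braids, so the permutation of `k.right`, shifted by one, is that
      -- of `b`.
      ext p
      have h1 := perm_ofArtinProduct_inr k.right p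
      rw [hbk, ← SemidirectProduct.inl_left_mul_inr_right k, map_mul, map_mul,
        perm_ofArtinProduct_inl, one_mul] at hp
      rw [hp] at h1
      simpa using h1.symm
    have hl : k.left = 1 := by
      have h1 := congrArg SemidirectProduct.left hkk
      rw [SemidirectProduct.mul_left, hr] at h1
      have h2 : k.left ^ 2 = 1 := by simpa [pow_two] using h1
      simpa using h2
    rw [hbk, show k = 1 from SemidirectProduct.ext hl hr, map_one]

/-- Commuting with the transposition of `i` and `i + 1` forces the permutation to preserve `{i, i +
1}`. Two consecutive pairs meet in one point, so interior points are fixed; then so are the two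
ends. -/
theorem perm_eq_one_of_central {m : ℕ} (hm : 2 ≤ m) (b : Braid m) (hb : ∀ c, b * c = c * b) :
    perm m b = 1 := by
  have key (i : ℕ) (hi : i < m) (p : ℕ) (hp : p = i ∨ p = i + 1) :
      perm m b p = i ∨ perm m b p = i + 1 := by
    by_contra! h
    have h1 := DFunLike.congr_fun (congrArg (perm m) (hb (σ m i))) p
    simp only [map_mul, Equiv.Perm.mul_apply, perm_σ hi] at h1
    rw [Equiv.swap_apply_of_ne_of_ne h.1 h.2] at h1
    have h2 := (perm m b).injective h1
    rcases hp with rfl | rfl <;> simp at h2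
  have h1 (p : ℕ) (hp : 1 ≤ p) (hpm : p < m) : perm m b p = p := by
    have h2 := key p hpm p (Or.inl rfl)
    have h3 := key (p - 1) (by omega) p (by omega)
    omega
  ext p
  rw [Equiv.Perm.one_apply]
  rcases Nat.lt_or_ge m p with hp | hp
  · exact perm_apply_of_lt b hp
  rcases Nat.eq_zero_or_pos p with rfl | hp0
  · have h2 := key 0 (by omega) 0 (by omega)
    have h3 := h1 1 le_rfl (by omega)
    have h4 : perm m b 0 ≠ perm m b 1 := fun h => absurd ((perm m b).injective h) (by omega)
    omega
  rcases Nat.lt_or_ge p m with hpm | hpm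
  · exact h1 p hp0 hpm
  · obtain rfl : p = m := by omega
    have h2 := key (p - 1) (by omega) p (by omega)
    have h3 := h1 (p - 1) (by omega) (by omega)
    have h4 : perm p b p ≠ perm p b (p - 1) := fun h => absurd ((perm p b).injective h) (by omega)
    omega

/-- The center of the braid group has no element of order two. -/
theorem eq_one_of_central_of_sq_eq_one {m : ℕ} (hm : 2 ≤ m) (b : Braid m)
    (hc : ∀ c, b * c = c * b) (hb : b ^ 2 = 1) : b = 1 :=
  eq_one_of_sq_eq_one b (perm_eq_one_of_central hm b hc) hb

end Braid

/-! ### Generators and relations of type `D`, numbered from the fork. -/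

/-- The relations of the Artin group of type `D` of rank `m + 1`: the elements `a 0, …, a (m - 1)`
generate a path of the Coxeter graph, and `e` is joined to `a 1`. -/
structure ForkRelations {H : Type*} [Group H] (m : ℕ) (a : ℕ → H) (e : H) : Prop where
  braid : BraidRelations m a
  comm_zero : e * a 0 = a 0 * e
  braid_one : e * a 1 * e = a 1 * e * a 1
  comm : ∀ k, 2 ≤ k → e * a k = a k * e

theorem ForkRelations.map {H H' : Type*} [Group H] [Group H'] {m : ℕ} {a : ℕ → H} {e : H}
    (h : ForkRelations m a e) (f : H →* H') : ForkRelations m (fun i => f (a i)) (f e) where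
  braid :=
    { eq_one := fun i hi => by simp only [h.braid.eq_one i hi, map_one]
      braid := fun i hi => by simp only [← map_mul, h.braid.braid i hi]
      comm := fun i j hi => by simp only [← map_mul, h.braid.comm i j hi] }
  comm_zero := by simp only [← map_mul, h.comm_zero]
  braid_one := by simp only [← map_mul, h.braid_one]
  comm k hk := by simp only [← map_mul, h.comm k hk]

namespace ArtinD

theorem coxeterMatrixD_of_edge {n : ℕ} {i j : Fin n}
    (h : DynkinDEdge n i j ∨ DynkinDEdge n j i) : coxeterMatrixD n i j = 3 := by
  have hij : i ≠ j := by rintro rfl; unfold DynkinDEdge at h; omega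
  exact (if_neg hij).trans (if_pos h)

theorem coxeterMatrixD_of_not_edge {n : ℕ} {i j : Fin n} (hij : i ≠ j)
    (h : ¬ (DynkinDEdge n i j ∨ DynkinDEdge n j i)) : coxeterMatrixD n i j = 2 :=
  (if_neg hij).trans (if_neg h)

theorem of_braid {n : ℕ} {i j : Fin n} (h : DynkinDEdge n i j) :
    (.of i * .of j * .of i : ArtinD n) = .of j * .of i * .of j := by
  -- `alternatingWord` ends in its second index, so the pair `j`, `i` yields the word `i j i` on the
  -- left.
  have := PresentedGroup.mk_eq_mk_of_mul_inv_mem (rels := artinRelators (coxeterMatrixD n))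
    ⟨j, i, rfl⟩
  rw [coxeterMatrixD_of_edge (.inr h)] at this
  simp only [CoxeterSystem.alternatingWord, List.concat, List.map, List.prod_cons, List.prod_nil,
    mul_one, map_mul, ← mul_assoc] at this
  exact this

theorem of_comm {n : ℕ} {i j : Fin n} (hij : i ≠ j) (h : ¬ DynkinDEdge n i j)
    (h' : ¬ DynkinDEdge n j i) : (.of i * .of j : ArtinD n) = .of j * .of i := by
  have := PresentedGroup.mk_eq_mk_of_mul_inv_mem (rels := artinRelators (coxeterMatrixD n))
    ⟨i, j, rfl⟩
  rw [coxeterMatrixD_of_not_edge hij (by tauto)] at this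
  simp only [CoxeterSystem.alternatingWord, List.concat, List.map, List.prod_cons, List.prod_nil,
    mul_one, map_mul] at this
  exact this

variable {m : ℕ}

/-- The generators on the long path of the Coxeter graph, starting at the fork. -/
def path (m k : ℕ) : ArtinD (m + 1) :=
  if k < m then .of ⟨m - 1 - k, by omega⟩ else 1

/-- The remaining generator. -/
def tip (m : ℕ) : ArtinD (m + 1) := .of (Fin.last m)

theorem relations (hm : 3 ≤ m) : ForkRelations m (path m) (tip m) where
  braid :=
    { eq_one := fun i hi => if_neg (by omega)
      braid := fun i hi => by
        rw [path, path, if_pos (by omega), if_pos hi]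
        exact (of_braid (Or.inl (by simp; omega))).symm
      comm := fun i j hij => by
        rw [path, path]
        split_ifs
        · exact of_comm (by simp; omega) (by simp [DynkinDEdge]; omega)
            (by simp [DynkinDEdge]; omega)
        all_goals simp }
  comm_zero := by
    rw [path, if_pos (by omega)]
    exact of_comm (by simp [Fin.ext_iff]; omega) (by simp [DynkinDEdge]; omega)
      (by simp [DynkinDEdge]; omega)
  braid_one := by
    rw [path, if_pos (by omega)]
    exact (of_braid (Or.inr (by simp; omega))).symm
  comm k hk := by
    rw [path]
    split_ifs
    · exact of_comm (by simp [Fin.ext_iff]; omega) (by simp [DynkinDEdge]; omega)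
        (by simp [DynkinDEdge]; omega)
    · simp

section lift
variable {H : Type*} [Group H] {a : ℕ → H} {e : H}

theorem exists_lift (h : ForkRelations m a e) :
    ∃ φ : ArtinD (m + 1) →* H, (∀ k, φ (path m k) = a k) ∧ φ (tip m) = e := by
  -- The vertices of the Coxeter graph are numbered towards the fork, the sequence `a` away from it;
  -- hence the reversal.
  set f : Fin (m + 1) → H := fun i => if i.val = m then e else a (m - 1 - i) with hf
  have hE (i j : Fin (m + 1)) (hij : DynkinDEdge (m + 1) i j) :
      f i * f j * f i = f j * f i * f j := by
    rcases hij with ⟨h1, h2⟩ | ⟨h1, h2⟩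
    · simp only [hf, if_neg (show i.val ≠ m by omega), if_neg (show j.val ≠ m by omega)]
      have := h.braid.braid (m - 1 - j) (by omega)
      rw [show m - 1 - j.val + 1 = m - 1 - i by omega] at this
      exact this.symm
    · simp only [hf, if_neg (show i.val ≠ m by omega), if_pos (show j.val = m by omega)]
      rw [show m - 1 - i.val = 1 by omega]
      exact h.braid_one.symm
  have hC (i j : Fin (m + 1)) (hne : i.val < j.val) (hij : ¬ DynkinDEdge (m + 1) i j) :
      f i * f j = f j * f i := by
    unfold DynkinDEdge at hij
    simp only [hf, if_neg (show i.val ≠ m by omega)]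
    split_ifs with h1
    · rcases Nat.eq_zero_or_pos (m - 1 - i.val) with h0 | h0
      · rw [h0, h.comm_zero]
      · rw [h.comm _ (by omega)]
    · exact (h.braid.comm _ _ (by omega)).symm
  have hr : ∀ r ∈ artinRelators (coxeterMatrixD (m + 1)), FreeGroup.lift f r = 1 := by
    rintro r ⟨i, j, rfl⟩
    rw [map_mul, map_inv, mul_inv_eq_one]
    by_cases hij : i = j
    · simp [hij]
    by_cases he : DynkinDEdge (m + 1) i j ∨ DynkinDEdge (m + 1) j i
    · have h3 : f i * f j * f i = f j * f i * f j := he.elim (hE i j) fun h => (hE j i h).symm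
      simpa [coxeterMatrixD, hij, Ne.symm hij, he, he.symm, CoxeterSystem.alternatingWord,
        mul_assoc] using h3.symm
    · have h3 : f i * f j = f j * f i := by
        rw [not_or] at he
        rcases Nat.lt_or_ge i j with h1 | h1
        · exact hC i j h1 he.1
        · exact (hC j i (lt_of_le_of_ne h1 fun h => hij (Fin.ext h.symm)) he.2).symm
      have he' : ¬ (DynkinDEdge (m + 1) j i ∨ DynkinDEdge (m + 1) i j) := fun h => he h.symm
      simpa only [coxeterMatrixD, Matrix.of_apply, if_neg hij, if_neg (Ne.symm hij), if_neg he,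
        if_neg he', CoxeterSystem.alternatingWord, List.concat, List.map, List.prod_cons,
        List.prod_nil, map_mul, map_one, mul_one, FreeGroup.lift_apply_of] using h3
  refine ⟨PresentedGroup.toGroup hr, fun k => ?_, ?_⟩
  · rw [path]
    split_ifs with hk
    · rw [PresentedGroup.toGroup.of]
      simp only [hf]
      rw [if_neg (by omega)]
      congr 1
      omega
    · rw [map_one, h.braid.eq_one k (by omega)]
  · rw [tip, PresentedGroup.toGroup.of]
    simp [hf]

theorem hom_ext {φ ψ : ArtinD (m + 1) →* H} (h : ∀ k, φ (path m k) = ψ (path m k))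
    (h' : φ (tip m) = ψ (tip m)) : φ = ψ := by
  refine PresentedGroup.ext fun i => ?_
  rcases Nat.lt_or_ge i.val m with hi | hi
  · have := h (m - 1 - i)
    rw [path, if_pos (by omega)] at this
    convert this using 3 <;> ext <;> simp <;> omega
  · obtain rfl : i = Fin.last m := Fin.ext (by simp; omega)
    exact h'

end lift

end ArtinD

/-! ### The Crisp–Paris semidirect product. -/

/-- The automorphism of the free group by which the first braid generator acts in the
decomposition of the Artin group of type `D` as a semidirect product. -/
def forkAut (m : ℕ) : MulAut (FreeGroup ℕ) :=
  MonoidHom.toMulEquiv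
    (FreeGroup.lift fun k => if 0 < k ∧ k < m then (.of 0)⁻¹ * .of k else .of k)
    (FreeGroup.lift fun k => if 0 < k ∧ k < m then .of 0 * .of k else .of k)
    (by ext k; by_cases h : 0 < k ∧ k < m <;> simp [h])
    (by ext k; by_cases h : 0 < k ∧ k < m <;> simp [h])

theorem forkAut_of_pos {m k : ℕ} (h : 0 < k) (h' : k < m) :
    forkAut m (.of k) = (.of 0)⁻¹ * .of k := by
  simp [forkAut, h, h']

theorem forkAut_of {m k : ℕ} (h : ¬ (0 < k ∧ k < m)) : forkAut m (.of k) = .of k := by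
  simp [forkAut, h]

/-- The automorphism of the free group by which the braid generator of index `i + 1` acts in the
decomposition of the Artin group of type `D` as a semidirect product. -/
def stepAut (i : ℕ) : MulAut (FreeGroup ℕ) :=
  MonoidHom.toMulEquiv
    (FreeGroup.lift fun k => if k = i then .of (i + 1)
      else if k = i + 1 then .of (i + 1) * (.of i)⁻¹ * .of (i + 1) else .of k)
    (FreeGroup.lift fun k => if k = i then .of i * (.of (i + 1))⁻¹ * .of i
      else if k = i + 1 then .of i else .of k)
    (by
      ext k
      by_cases h : k = i
      · simp [h]
      · by_cases h' : k = i + 1 <;> simp [h, h', mul_assoc])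
    (by
      ext k
      by_cases h : k = i
      · simp [h, mul_assoc]
      · by_cases h' : k = i + 1 <;> simp [h, h'])

theorem stepAut_of_self (i : ℕ) : stepAut i (.of i) = .of (i + 1) := by
  simp [stepAut]

theorem stepAut_of_succ (i : ℕ) :
    stepAut i (.of (i + 1)) = .of (i + 1) * (.of i)⁻¹ * .of (i + 1) := by
  simp [stepAut]

theorem stepAut_of_ne {i k : ℕ} (h : k ≠ i) (h' : k ≠ i + 1) : stepAut i (.of k) = .of k := by
  simp [stepAut, h, h']

theorem forkAut_stepAut_braid {m : ℕ} (hm : 1 < m) :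
    forkAut m * stepAut 0 * forkAut m = stepAut 0 * forkAut m * stepAut 0 := by
  refine MulAut.freeGroup_ext fun k => ?_
  simp only [MulAut.mul_apply]
  have h0 : forkAut m (.of 0) = .of 0 := forkAut_of (by omega)
  have h1 := forkAut_of_pos zero_lt_one hm
  have h2 := stepAut_of_self 0
  have h3 := stepAut_of_succ 0
  rw [zero_add] at h2 h3
  rcases Nat.lt_or_ge k 2 with hk | hk
  · interval_cases k
    · simp [h0, h1, h2, h3, mul_assoc]
    · simp [h0, h1, h2, h3, mul_assoc]
  · have h4 := stepAut_of_ne (i := 0) (k := k) (by omega) (by omega)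
    by_cases hkm : k < m
    · simp [h1, h2, h4, forkAut_of_pos (by omega) hkm]
    · simp [h4, forkAut_of (m := m) (k := k) (by omega)]

theorem forkAut_stepAut_comm {m i : ℕ} (hi : 0 < i) (hm : i + 1 < m) :
    forkAut m * stepAut i = stepAut i * forkAut m := by
  refine MulAut.freeGroup_ext fun k => ?_
  simp only [MulAut.mul_apply]
  have h0 : stepAut i (.of 0) = .of 0 := stepAut_of_ne (by omega) (by omega)
  have h1 := forkAut_of_pos hi (show i < m by omega)
  have h2 := forkAut_of_pos (Nat.succ_pos i) hm
  rw [Nat.succ_eq_add_one] at h2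
  by_cases hk : k = i
  · subst hk
    simp [h0, h1, h2, stepAut_of_self]
  by_cases hk' : k = i + 1
  · subst hk'
    simp [h0, h1, h2, stepAut_of_succ, mul_assoc]
  rw [stepAut_of_ne hk hk']
  by_cases hkm : 0 < k ∧ k < m
  · simp [forkAut_of_pos hkm.1 hkm.2, h0, stepAut_of_ne hk hk']
  · simp [forkAut_of hkm, stepAut_of_ne hk hk']

theorem stepAut_braid (i : ℕ) :
    stepAut i * stepAut (i + 1) * stepAut i = stepAut (i + 1) * stepAut i * stepAut (i + 1) := by
  refine MulAut.freeGroup_ext fun k => ?_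
  simp only [MulAut.mul_apply]
  have h1 := stepAut_of_self i
  have h2 := stepAut_of_succ i
  have h3 := stepAut_of_self (i + 1)
  have h4 := stepAut_of_succ (i + 1)
  have h5 : stepAut i (.of (i + 2)) = .of (i + 2) := stepAut_of_ne (by omega) (by omega)
  have h6 : stepAut (i + 1) (.of i) = .of i := stepAut_of_ne (by omega) (by omega)
  simp only [add_assoc, Nat.reduceAdd] at h3 h4
  by_cases hk : k = i
  · subst hk
    simp [h1, h3, h5, h6]
  by_cases hk' : k = i + 1
  · subst hk'
    simp [h1, h2, h3, h4, h5, h6, mul_assoc]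
  by_cases hk'' : k = i + 2
  · subst hk''
    simp [h2, h3, h4, h5, h6, mul_assoc]
  simp [stepAut_of_ne hk hk', stepAut_of_ne (i := i + 1) hk' (by omega)]

theorem stepAut_comm {i j : ℕ} (hij : i + 2 ≤ j) :
    stepAut i * stepAut j = stepAut j * stepAut i := by
  refine MulAut.freeGroup_ext fun k => ?_
  simp only [MulAut.mul_apply]
  have h1 : stepAut j (.of i) = .of i := stepAut_of_ne (by omega) (by omega)
  have h2 : stepAut j (.of (i + 1)) = .of (i + 1) := stepAut_of_ne (by omega) (by omega)
  have h3 : stepAut i (.of j) = .of j := stepAut_of_ne (by omega) (by omega)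
  have h4 : stepAut i (.of (j + 1)) = .of (j + 1) := stepAut_of_ne (by omega) (by omega)
  by_cases hk : k = i
  · subst hk; simp [h1, h2, stepAut_of_self]
  by_cases hk1 : k = i + 1
  · subst hk1; simp [h1, h2, stepAut_of_succ]
  by_cases hk2 : k = j
  · subst hk2; simp [h3, h4, stepAut_of_self]
  by_cases hk3 : k = j + 1
  · subst hk3; simp [h3, h4, stepAut_of_succ]
  simp [stepAut_of_ne hk hk1, stepAut_of_ne hk2 hk3]

/-- The automorphisms of the free group by which the braid generators act in the decomposition of
the Artin group of type `D` as a semidirect product. -/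
def crispParisAut (m : ℕ) : ℕ → MulAut (FreeGroup ℕ)
  | 0 => forkAut m
  | i + 1 => stepAut i

theorem crispParisAut_relations (m : ℕ) : BraidRelations m (cutoff m (crispParisAut m)) := by
  refine .cutoff (fun i hi => ?_) (fun i j hij hj => ?_)
  · match i with
    | 0 => exact forkAut_stepAut_braid hi
    | i + 1 => exact stepAut_braid i
  · match i, j, hij with
    | 0, j + 1, hij => exact forkAut_stepAut_comm (by omega) hj
    | i + 1, j + 1, hij => exact stepAut_comm (by omega)

/-- The action of the braid group on the free group in the decomposition of the Artin group of
type `D` as a semidirect product. -/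
def Braid.crispParisRep (m : ℕ) : Braid m →* MulAut (FreeGroup ℕ) :=
  Braid.lift (crispParisAut_relations m)

theorem Braid.crispParisRep_σ {m i : ℕ} (h : i < m) :
    Braid.crispParisRep m (Braid.σ m i) = crispParisAut m i :=
  (Braid.lift_σ _ _).trans (cutoff_of_lt h)

/-- The semidirect product of a free group and a braid group containing the Artin group of
type `D`. -/
abbrev CrispParisProduct (m : ℕ) : Type := FreeGroup ℕ ⋊[Braid.crispParisRep m] Braid m

namespace CrispParisProduct
open SemidirectProduct

theorem conj_inl (m i : ℕ) (h : i < m) (f : FreeGroup ℕ) :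
    (inr (Braid.σ m i) * inl f : CrispParisProduct m) =
      inl (crispParisAut m i f) * inr (Braid.σ m i) := by
  rw [← Braid.crispParisRep_σ h, inl_aut]
  simp [mul_assoc]

/-- The factor `(.of 0)⁻¹` in `forkAut` serves the relation `braid_one`: it cancels the leading free
generator, and both sides become `.of 1` times the same positive braid. -/
theorem relations {m : ℕ} (hm : 3 ≤ m) :
    ForkRelations m (fun i => (inr (Braid.σ m i) : CrispParisProduct m))
      (inl (.of 0) * inr (Braid.σ m 0)) where
  braid :=
    { eq_one := fun i h => by simp [(Braid.relations m).eq_one i h]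
      braid := fun i h => by simp only [← map_mul, (Braid.relations m).braid i h]
      comm := fun i j h => by simp only [← map_mul, (Braid.relations m).comm i j h] }
  comm_zero := by
    rw [← mul_assoc, conj_inl m 0 (by omega), crispParisAut, forkAut_of (by omega)]
  braid_one := by
    have h1 := (Braid.relations m).braid 0 (by omega)
    have h2 : forkAut m (.of 1) = (.of 0)⁻¹ * .of 1 := forkAut_of_pos (by omega) (by omega)
    rw [zero_add] at h1
    calc (inl (.of 0) * inr (Braid.σ m 0)) * inr (Braid.σ m 1) *
          (inl (.of 0) * inr (Braid.σ m 0))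
        = (inl (.of 0) * (inr (Braid.σ m 0) * (inr (Braid.σ m 1) * inl (.of 0))) *
          inr (Braid.σ m 0) : CrispParisProduct m) := by simp only [mul_assoc]
      _ = inl (.of 1) * inr (Braid.σ m 0 * Braid.σ m 1 * Braid.σ m 0) := by
        rw [conj_inl m 1 (by omega), crispParisAut, stepAut_of_self,
          ← mul_assoc (inr (Braid.σ m 0)), conj_inl m 0 (by omega), crispParisAut, zero_add, h2]
        simp [mul_assoc]
      _ = (inr (Braid.σ m 1) * inl (.of 0)) * inr (Braid.σ m 0) * inr (Braid.σ m 1) := by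
        rw [conj_inl m 1 (by omega), crispParisAut, stepAut_of_self, h1]
        simp [mul_assoc]
      _ = _ := by simp only [mul_assoc]
  comm k hk := by
    rcases Nat.lt_or_ge k m with hkm | hkm
    · obtain ⟨k, rfl⟩ : ∃ j, k = j + 1 := ⟨k - 1, by omega⟩
      rw [← mul_assoc, conj_inl m _ hkm, crispParisAut, stepAut_of_ne (by omega) (by omega),
        mul_assoc, mul_assoc, ← map_mul, ← map_mul, (Braid.relations m).comm 0 _ hk]
    · simp [(Braid.relations m).eq_one k hkm]

end CrispParisProduct

/-! ### The homomorphism back from the semidirect product. -/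

section kernelGen
variable {H : Type*} [Group H] {m : ℕ}

/-- The images of `u` under products of the automorphisms `A 1`, …, `A k`. -/
def kernelGen (A : ℕ → MulAut H) (u : H) : ℕ → H
  | 0 => u
  | k + 1 => A (k + 1) (kernelGen A u k)

variable {A : ℕ → MulAut H} {u : H}

theorem kernelGen_of_lt (hA : BraidRelations m A) (h2 : ∀ k, 2 ≤ k → A k u = u) {i k : ℕ}
    (h : k + 2 ≤ i) : A i (kernelGen A u k) = kernelGen A u k := by
  induction k with
  | zero => exact h2 i h
  | succ k ih =>
    rw [kernelGen, ← MulAut.mul_apply, ← hA.comm (k + 1) i h, MulAut.mul_apply, ih (by omega)]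

/-- For `k = i + 2`, the braid relation turns `A (i + 1) * A (i + 2) * A (i + 1)` around, and `A (i
+ 2)` fixes `kernelGen A u i`. Larger `k` follow by commutation. -/
theorem kernelGen_of_gt (hA : BraidRelations m A) (h2 : ∀ k, 2 ≤ k → A k u = u) {i k : ℕ}
    (h : i + 2 ≤ k) (hk : k < m) : A (i + 1) (kernelGen A u k) = kernelGen A u k := by
  induction k, h using Nat.le_induction with
  | base =>
    have h1 := DFunLike.congr_fun (hA.braid (i + 1) hk) (kernelGen A u i)
    simp only [MulAut.mul_apply] at h1
    rw [kernelGen_of_lt hA h2 le_rfl] at h1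
    exact h1
  | succ k hik ih =>
    rw [kernelGen, ← MulAut.mul_apply, hA.comm (i + 1) (k + 1) (by omega), MulAut.mul_apply,
      ih (by omega)]

theorem kernelGen_zero (hA : BraidRelations m A) (h2 : ∀ k, 2 ≤ k → A k u = u)
    (h1 : A 0 (A 1 u) = u⁻¹ * A 1 u) {k : ℕ} (hk : 1 ≤ k) :
    A 0 (kernelGen A u k) = u⁻¹ * kernelGen A u k := by
  induction k, hk using Nat.le_induction with
  | base => exact h1
  | succ k hk ih =>
    rw [kernelGen, ← MulAut.mul_apply, hA.comm 0 (k + 1) (by omega), MulAut.mul_apply, ih, map_mul,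
      map_inv, h2 _ (by omega)]

/-- The case `k = 0` is the braid relation of `A 0` and `A 1` evaluated at `u`. Applying `A (k + 1)
* A (k + 2)` to the formula for `k` gives the next one. -/
theorem kernelGen_self (hA : BraidRelations m A) (h0 : A 0 u = u) (h2 : ∀ k, 2 ≤ k → A k u = u)
    (h1 : A 0 (A 1 u) = u⁻¹ * A 1 u) {k : ℕ} (hk : k + 1 < m) :
    A (k + 1) (kernelGen A u (k + 1)) =
      kernelGen A u (k + 1) * (kernelGen A u k)⁻¹ * kernelGen A u (k + 1) := by
  induction k with
  | zero =>
    have h3 := DFunLike.congr_fun (hA.braid 0 hk) u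
    simp only [MulAut.mul_apply, zero_add, h0, h1, map_mul, map_inv] at h3
    simp only [kernelGen, zero_add]
    rw [mul_assoc, h3, mul_inv_cancel_left]
  | succ k ih =>
    have h3 := congrArg (fun y => A (k + 1) (A (k + 1 + 1) y)) (ih (by omega))
    have h4 := DFunLike.congr_fun (hA.braid (k + 1) hk) (kernelGen A u (k + 1))
    have h5 : A (k + 1 + 1) (kernelGen A u (k + 1)) = kernelGen A u (k + 1 + 1) := rfl
    have h6 : A (k + 1) (kernelGen A u k) = kernelGen A u (k + 1) := rfl
    have h7 := kernelGen_of_gt hA h2 (i := k) (k := k + 1 + 1) (by omega) hk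
    have h8 := kernelGen_of_lt hA h2 (i := k + 1 + 1) (k := k) (by omega)
    simp only [MulAut.mul_apply, map_mul, map_inv, h5, h6, h7, h8] at h3 h4
    rw [← h4, h3]

end kernelGen

/-- The homomorphism from the semidirect product to a group with the relations of the Artin group
of type `D`. -/
theorem CrispParisProduct.exists_lift {H : Type*} [Group H] {m : ℕ} {a : ℕ → H} {e : H} (hm : 3 ≤ m)
    (h : ForkRelations m a e) : ∃ φ : CrispParisProduct m →* H,
      (∀ k, φ (SemidirectProduct.inr (Braid.σ m k)) = a k) ∧
      φ (SemidirectProduct.inl (.of 0)) = e * (a 0)⁻¹ := by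
  set u := e * (a 0)⁻¹ with hu
  set A : ℕ → MulAut H := fun k => MulAut.conj (a k) with hAdef
  have hA : BraidRelations m A := (h.map MulAut.conj).braid
  have h0 : A 0 u = u := by
    simp only [hAdef, MulAut.conj_apply, hu]
    rw [← mul_assoc, ← h.comm_zero]
    group
  have h2 (k : ℕ) (hk : 2 ≤ k) : A k u = u := by
    have h1 : Commute (a k) e := (h.comm k hk).symm
    have h3 : Commute (a k) (a 0) := (h.braid.comm 0 k hk).symm
    exact mul_inv_eq_of_eq_mul (h1.mul_right h3.inv_right).eq
  -- This is `braid_one` rewritten with `e = u * a 0`.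
  have h1 : A 0 (A 1 u) = u⁻¹ * A 1 u := by
    have hb : a 0 * a 1 * a 0 = a 1 * a 0 * a 1 := h.braid.braid 0 (by omega)
    have he : e = u * a 0 := by simp [hu]
    have h3 : u * (a 0 * a 1 * u * a 0) = a 1 * u * (a 0 * a 1) := by
      have := h.braid_one
      rw [he] at this
      simpa only [mul_assoc] using this
    simp only [hAdef, MulAut.conj_apply]
    rw [eq_inv_mul_iff_mul_eq]
    have h4 : (a 1)⁻¹ * (a 0)⁻¹ = a 0 * (a 0 * a 1 * a 0)⁻¹ := by group
    have h5 : a 0 * a 1 * (a 1 * a 0 * a 1)⁻¹ = (a 1)⁻¹ := by group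
    calc u * (a 0 * (a 1 * u * (a 1)⁻¹) * (a 0)⁻¹)
        = u * (a 0 * a 1 * u * ((a 1)⁻¹ * (a 0)⁻¹)) := by group
      _ = u * (a 0 * a 1 * u * a 0) * (a 1 * a 0 * a 1)⁻¹ := by rw [h4, hb]; group
      _ = a 1 * u * (a 0 * a 1 * (a 1 * a 0 * a 1)⁻¹) := by rw [h3]; group
      _ = _ := by rw [h5]
  -- The free generators of index at least `m` are fixed by the whole action, so they can be sent to
  -- `1`.
  refine ⟨SemidirectProduct.lift (FreeGroup.lift fun k => if k < m then kernelGen A u k else 1)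
    (Braid.lift h.braid) (Braid.conj_compat _ _ _ fun i hi k => ?_), fun k => by simp, ?_⟩
  · rw [Braid.crispParisRep_σ hi, Braid.lift_σ]
    refine eq_mul_inv_iff_mul_eq.1 ?_
    rw [← MulAut.conj_apply]
    change _ = A i _
    rcases Nat.lt_or_ge k m with hk | hk
    · match i with
      | 0 =>
        rcases Nat.eq_zero_or_pos k with rfl | hk0
        · simp [crispParisAut, forkAut_of, hk, kernelGen, h0]
        · simp [crispParisAut, forkAut_of_pos hk0 hk, hk, hi, kernelGen_zero hA h2 h1 hk0]
          rfl
      | i + 1 =>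
        rw [crispParisAut]
        by_cases hki : k = i
        · subst hki
          simp [stepAut_of_self, hk, hi, kernelGen]
        by_cases hki' : k = i + 1
        · subst hki'
          simp [stepAut_of_succ, hk, show i < m by omega, kernelGen_self hA h0 h2 h1 hk]
        rw [stepAut_of_ne hki hki', FreeGroup.lift_apply_of, if_pos hk]
        rcases Nat.lt_or_ge k i with hlt | hge
        · rw [kernelGen_of_lt hA h2 (by omega)]
        · rw [kernelGen_of_gt hA h2 (by omega) hk]
    · have h3 : crispParisAut m i (.of k) = .of k := by
        match i with
        | 0 => exact forkAut_of (by omega)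
        | i + 1 => exact stepAut_of_ne (by omega) (by omega)
      rw [h3, FreeGroup.lift_apply_of, if_neg (by omega), map_one]
  · simp [kernelGen, show 0 < m by omega]

/-! ### The center in type `D` has no element of order two. -/

namespace ArtinD
variable {m : ℕ}

/-- The center of the Artin group of type `D` has no element of order two. -/
theorem eq_one_of_central_of_sq_eq_one (hm : 3 ≤ m) (z : ArtinD (m + 1))
    (hz : z ∈ Subgroup.center (ArtinD (m + 1))) (hz2 : z ^ 2 = 1) : z = 1 := by
  obtain ⟨φ, hφ, hφ'⟩ := exists_lift (CrispParisProduct.relations hm)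
  obtain ⟨θ, hθ, hθ'⟩ := CrispParisProduct.exists_lift hm (relations hm)
  -- This one-sided inverse already makes `φ` injective.
  have hinj : θ.comp φ = MonoidHom.id _ :=
    hom_ext (fun k => by simp [hφ, hθ]) (by simp [hφ', hθ, hθ'])
  have h1 : (φ z) ^ 2 = 1 := by rw [← map_pow, hz2, map_one]
  have hr : (φ z).right = 1 := by
    refine Braid.eq_one_of_central_of_sq_eq_one (by omega) _ (fun c => ?_)
      (by rw [← SemidirectProduct.rightHom_eq_right, ← map_pow, h1, map_one])
    -- The braid component of `φ` hits all generators `σ`, so it takes central elements to central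
    -- braids.
    induction c using Braid.induction with
    | one => simp
    | gen i hi =>
      have h2 := congrArg (fun y => (φ y).right) (Subgroup.mem_center_iff.1 hz (path m i))
      simpa [hφ] using h2.symm
    | mul a b ha hb => exact (Commute.mul_right (show Commute _ a from ha) hb)
    | inv a ha => exact (Commute.inv_right (show Commute _ a from ha))
  have hl : (φ z).left = 1 := by
    have h2 : (φ z).left ^ 2 = 1 := by
      simpa [pow_two, hr] using congrArg SemidirectProduct.left h1
    simpa using h2
  have h2 : φ z = 1 := SemidirectProduct.ext hl hr
  have h3 := DFunLike.congr_fun hinj z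
  rw [MonoidHom.comp_apply, h2, map_one] at h3
  exact h3.symm

end ArtinD

/-! ### Conjugations that swap elements, and lifting single relations. -/

/-- Two elements of a group that are interchanged by conjugation. -/
def Swappable {G : Type*} [Group G] (x y : G) : Prop :=
  ∃ g : G, g * x * g⁻¹ = y ∧ g * y * g⁻¹ = x

section Swappable
variable {G : Type*} [Group G] {x y z : G}

theorem Swappable.symm (h : Swappable x y) : Swappable y x :=
  let ⟨g, h1, h2⟩ := h
  ⟨g, h2, h1⟩

theorem Swappable.map {H : Type*} [Group H] (h : Swappable x y) (f : G →* H) :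
    Swappable (f x) (f y) :=
  let ⟨g, h1, h2⟩ := h
  ⟨f g, by simp only [← map_inv, ← map_mul, h1], by simp only [← map_inv, ← map_mul, h2]⟩

/-- The end generators of a Coxeter graph of type `A₃` are swapped by the Garside element. -/
theorem Swappable.of_braid_braid (hxy : x * y * x = y * x * y) (hyz : y * z * y = z * y * z)
    (hxz : x * z = z * x) : Swappable x z := by
  refine ⟨x * y * z * x * y * x, mul_inv_eq_of_eq_mul ?_, mul_inv_eq_of_eq_mul ?_⟩
  · calc x * y * z * x * y * x * x = x * y * z * (x * y * x) * x := by simp only [mul_assoc]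
      _ = x * (y * z * y) * x * y * x := by rw [hxy]; simp only [mul_assoc]
      _ = (x * z) * y * (z * x) * y * x := by rw [hyz]; simp only [mul_assoc]
      _ = z * (x * y * (x * z) * y * x) := by rw [hxz]; simp only [mul_assoc]
      _ = z * (x * y * z * x * y * x) := by rw [hxz]; simp only [mul_assoc]
  · calc x * y * z * x * y * x * z = x * y * z * x * y * (x * z) := by simp only [mul_assoc]
      _ = x * y * (z * x) * (y * z * x) := by rw [hxz]; simp only [mul_assoc]
      _ = x * y * x * (z * y * z) * x := by rw [← hxz]; simp only [mul_assoc]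
      _ = x * (y * x * y) * z * y * x := by rw [← hyz]; simp only [mul_assoc]
      _ = x * (x * y * x * z * y * x) := by rw [← hxy]; simp only [mul_assoc]
      _ = x * (x * y * (x * z) * y * x) := by simp only [mul_assoc]
      _ = x * (x * y * z * x * y * x) := by rw [hxz]; simp only [mul_assoc]

/-- Conjugation by `x * y` takes `x` to `y` and fixes `z`, so it transports a swap of `y` and `z` to
one of `x` and `z`. -/
theorem Swappable.of_braid (hxy : x * y * x = y * x * y) (hxz : x * z = z * x)
    (hyz : y * z = z * y) (h : Swappable y z) : Swappable x z := by
  obtain ⟨g, h1, h2⟩ := h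
  have hx : MulAut.conj (x * y) x = y := mul_inv_eq_of_eq_mul (by rw [hxy]; simp only [mul_assoc])
  have hz : MulAut.conj (x * y) z = z :=
    mul_inv_eq_of_eq_mul (by rw [mul_assoc, hyz, ← mul_assoc, hxz, mul_assoc])
  have h1' : MulAut.conj g y = z := h1
  have h2' : MulAut.conj g z = y := h2
  have hx' : (MulAut.conj (x * y))⁻¹ y = x :=
    (congrArg _ hx.symm).trans (MulAut.inv_apply_self _ _ _)
  have hz' : (MulAut.conj (x * y))⁻¹ z = z :=
    (congrArg _ hz.symm).trans (MulAut.inv_apply_self _ _ _)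
  refine ⟨(x * y)⁻¹ * g * (x * y), ?_, ?_⟩ <;> rw [← MulAut.conj_apply, map_mul, map_mul, map_inv,
    MulAut.mul_apply, MulAut.mul_apply]
  · rw [hx, h1', hz']
  · rw [hz, h2', hx']

/-- If commuting elements of `G ⧸ Z(G)` are swapped by conjugation, then the commutator of lifts to
`G` is a central element with trivial square. -/
theorem commute_of_swappable_mod_center
    (hG : ∀ c ∈ Subgroup.center G, c ^ 2 = 1 → c = 1)
    (hxy : (x * y : ModCenter G) = y * x) (h : Swappable (x : ModCenter G) y) :
    x * y = y * x := by
  obtain ⟨g, h1, h2⟩ := h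
  obtain ⟨g, rfl⟩ := QuotientGroup.mk_surjective g
  have hc : x⁻¹ * y⁻¹ * x * y ∈ Subgroup.center G := by
    rw [← QuotientGroup.eq_one_iff]
    simp only [QuotientGroup.mk_mul, QuotientGroup.mk_inv]
    rw [mul_assoc _ (x : ModCenter G) y, hxy]
    group
  obtain ⟨c, hc1, hc2⟩ : ∃ c ∈ Subgroup.center G, g * x * g⁻¹ = y * c :=
    ⟨y⁻¹ * (g * x * g⁻¹), QuotientGroup.eq.1 h1.symm, by group⟩
  obtain ⟨d, hd1, hd2⟩ : ∃ d ∈ Subgroup.center G, g * y * g⁻¹ = x * d :=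
    ⟨x⁻¹ * (g * y * g⁻¹), QuotientGroup.eq.1 h2.symm, by group⟩
  set z := x⁻¹ * y⁻¹ * x * y with hzdef
  have hz1 : g * z * g⁻¹ = z := by rw [Subgroup.mem_center_iff.1 hc g]; group
  -- The central factors `c` and `d` drop out of the commutator, so swapping its entries yields
  -- `z⁻¹`.
  have hz2 : g * z * g⁻¹ = y⁻¹ * x⁻¹ * y * x := by
    have h3 : g * z * g⁻¹ = (g * x * g⁻¹)⁻¹ * (g * y * g⁻¹)⁻¹ * (g * x * g⁻¹) * (g * y * g⁻¹) := by
      rw [hzdef]; group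
    have hc3 (w : G) : Commute c w := (Subgroup.mem_center_iff.1 hc1 w).symm
    have hd3 (w : G) : Commute d w := (Subgroup.mem_center_iff.1 hd1 w).symm
    rw [h3, hc2, hd2]
    calc (y * c)⁻¹ * (x * d)⁻¹ * (y * c) * (x * d)
        = c⁻¹ * y⁻¹ * (d⁻¹ * x⁻¹ * y) * c * x * d := by group
      _ = c⁻¹ * (y⁻¹ * d⁻¹) * x⁻¹ * y * x * c * d := by
        rw [mul_assoc _ c x, (hc3 x).eq]; group
      _ = c⁻¹ * (d⁻¹ * (y⁻¹ * x⁻¹ * y * x * c)) * d := by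
        rw [← ((hd3 y⁻¹).inv_left).eq]; group
      _ = c⁻¹ * d⁻¹ * (d * (y⁻¹ * x⁻¹ * y * x * c)) := by rw [(hd3 _).eq]; group
      _ = c⁻¹ * (c * (y⁻¹ * x⁻¹ * y * x)) := by rw [(hc3 _).eq]; group
      _ = _ := by group
  have hz3 : z ^ 2 = 1 := by
    rw [pow_two]
    nth_rewrite 2 [← hz1]
    rw [hz2, hzdef]
    group
  have hz4 := hG z hc hz3
  calc x * y = y * x * z := by rw [hzdef]; group
    _ = y * x := by rw [hz4, mul_one]

theorem exists_braid_lift (x : G) (q : ModCenter G) (h : (x : ModCenter G) * q * x = q * x * q) :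
    ∃ y : G, (y : ModCenter G) = q ∧ x * y * x = y * x * y := by
  obtain ⟨y, rfl⟩ := QuotientGroup.mk_surjective q
  have hc : (y * x * y)⁻¹ * (x * y * x) ∈ Subgroup.center G := QuotientGroup.eq.1 h.symm
  set c := (y * x * y)⁻¹ * (x * y * x) with hcdef
  have hcc (w : G) : Commute c w := (Subgroup.mem_center_iff.1 hc w).symm
  refine ⟨y * c, ?_, ?_⟩
  -- The witness `y * c` works because `y` occurs once on the left of the relation and twice on the
  -- right.
  · rw [QuotientGroup.mk_mul, (QuotientGroup.eq_one_iff c).2 hc, mul_one]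
  · have h1 : x * y * x = y * x * y * c := by rw [hcdef]; group
    calc x * (y * c) * x = x * y * (c * x) := by simp only [mul_assoc]
      _ = x * y * x * c := by rw [(hcc x).eq]; simp only [mul_assoc]
      _ = y * (x * y * c) * c := by rw [h1]; simp only [mul_assoc]
      _ = y * c * x * (y * c) := by rw [← (hcc (x * y)).eq]; simp only [mul_assoc]

end Swappable

/-! ### Lifting the relations of type `D` and the endomorphism. -/

/-- Indices at distance two are the ends of an `A₃`. At larger distance, `a i` is conjugated to `a
(i + 1)` while `a j` stays fixed. -/
theorem BraidRelations.swappable {H : Type*} [Group H] {m : ℕ} {a : ℕ → H}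
    (h : BraidRelations m a) {i j : ℕ} (hij : i + 2 ≤ j) (hj : j < m) :
    Swappable (a i) (a j) := by
  induction d : j - (i + 2) generalizing i with
  | zero =>
    obtain rfl : j = i + 2 := by omega
    exact .of_braid_braid (h.braid i (by omega)) (h.braid (i + 1) hj) (h.comm i _ hij)
  | succ d ih =>
    exact .of_braid (h.braid i (by omega)) (h.comm i j hij) (h.comm (i + 1) j (by omega))
      (ih (by omega) (by omega))

theorem ForkRelations.swappable_zero {H : Type*} [Group H] {m : ℕ} {a : ℕ → H} {e : H}
    (hm : 3 ≤ m) (h : ForkRelations m a e) : Swappable e (a 0) :=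
  .of_braid_braid h.braid_one (h.braid.braid 0 (by omega)).symm h.comm_zero

theorem ForkRelations.swappable {H : Type*} [Group H] {m : ℕ} {a : ℕ → H} {e : H}
    (h : ForkRelations m a e) {k : ℕ} (hk : 2 ≤ k) (hkm : k < m) : Swappable e (a k) := by
  induction k, hk using Nat.le_induction with
  | base => exact .of_braid_braid h.braid_one (h.braid.braid 1 hkm) (h.comm 2 le_rfl)
  | succ k hk ih =>
    exact (Swappable.of_braid (h.braid.braid k hkm).symm (h.comm _ (by omega)).symm
      (h.comm k hk).symm (ih (by omega)).symm).symm

/-- The relations of the Artin group of type `D` lift from `G ⧸ Z(G)` to `G`, if the center of `G`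
has no element of order two. -/
theorem ForkRelations.exists_lift_mod_center {G : Type*} [Group G] {m : ℕ} (hm : 3 ≤ m)
    (hG : ∀ c ∈ Subgroup.center G, c ^ 2 = 1 → c = 1) {q : ℕ → ModCenter G} {r : ModCenter G}
    (h : ForkRelations m q r) :
    ∃ (a : ℕ → G) (e : G), ForkRelations m a e ∧ (∀ k, (a k : ModCenter G) = q k) ∧
      (e : ModCenter G) = r := by
  -- One step along the path. The correction alters only the new lift, so earlier braid relations
  -- persist; from index `m` on the choice is irrelevant and is cut off below.
  have step (k : ℕ) (x : {x : G // (x : ModCenter G) = q k}) :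
      ∃ y : {y : G // (y : ModCenter G) = q (k + 1)},
        k + 1 < m → x.1 * y.1 * x.1 = y.1 * x.1 * y.1 := by
    by_cases hk : k + 1 < m
    · obtain ⟨y, hy, hxy⟩ := exists_braid_lift x.1 (q (k + 1)) (by rw [x.2]; exact h.braid.braid k hk)
      exact ⟨⟨y, hy⟩, fun _ => hxy⟩
    · obtain ⟨y, hy⟩ := QuotientGroup.mk_surjective (q (k + 1))
      exact ⟨⟨y, hy⟩, fun h => absurd h hk⟩
  choose next hnext using step
  obtain ⟨x₀, hx₀⟩ := QuotientGroup.mk_surjective (q 0)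
  let b : ∀ k, {x : G // (x : ModCenter G) = q k} := fun k =>
    Nat.rec ⟨x₀, hx₀⟩ (fun k x => next k x) k
  have hb (k : ℕ) (hk : k + 1 < m) :
      (b k).1 * (b (k + 1)).1 * (b k).1 = (b (k + 1)).1 * (b k).1 * (b (k + 1)).1 :=
    hnext k (b k) hk
  set a : ℕ → G := cutoff m fun k => (b k).1 with ha
  have haq (k : ℕ) : (a k : ModCenter G) = q k := by
    rcases Nat.lt_or_ge k m with hk | hk
    · rw [ha, cutoff_of_lt hk, (b k).2]
    · rw [ha, cutoff_of_le hk, h.braid.eq_one k hk, QuotientGroup.mk_one]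
  obtain ⟨e, her, he⟩ := exists_braid_lift (a 1) r (by rw [haq]; exact h.braid_one.symm)
  have key {x y : G} (h1 : (x * y : ModCenter G) = y * x) (h2 : Swappable (x : ModCenter G) y) :
      x * y = y * x := commute_of_swappable_mod_center hG h1 h2
  refine ⟨a, e, ⟨.cutoff hb fun i j hij hj => ?_, ?_, he.symm, fun k hk => ?_⟩, haq, her⟩
  · refine key ?_ ?_ <;> rw [(b i).2, (b j).2]
    · exact h.braid.comm i j hij
    · exact h.braid.swappable hij hj
  · refine key ?_ ?_ <;> rw [her, haq]
    · exact h.comm_zero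
    · exact h.swappable_zero hm
  · rcases Nat.lt_or_ge k m with hkm | hkm
    · refine key ?_ ?_ <;> rw [her, haq]
      · exact h.comm k hk
      · exact h.swappable hk hkm
    · rw [ha, cutoff_of_le hkm, mul_one, one_mul]

theorem propositionA1 (n : ℕ) (hn : 4 ≤ n) (ψ : ModCenter (ArtinD n) →* ModCenter (ArtinD n)) :
    ∃ φ : ArtinD n →* ArtinD n, IsLiftModCenter φ ψ := by
  obtain ⟨m, rfl⟩ : ∃ m, n = m + 1 := ⟨n - 1, by omega⟩
  have hm : 3 ≤ m := by omega
  obtain ⟨a, e, hae, ha, he⟩ := ForkRelations.exists_lift_mod_center hm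
    (ArtinD.eq_one_of_central_of_sq_eq_one hm)
    ((ArtinD.relations hm).map (ψ.comp (QuotientGroup.mk' _)))
  obtain ⟨φ, hφ, hφ'⟩ := ArtinD.exists_lift hae
  -- Agreement on generators modulo the center gives both that `φ` preserves the center and that it
  -- induces `ψ`.
  have hcomp : (QuotientGroup.mk' (Subgroup.center (ArtinD (m + 1)))).comp φ =
      ψ.comp (QuotientGroup.mk' _) :=
    ArtinD.hom_ext (fun k => by simpa [hφ] using ha k) (by simpa [hφ'] using he)
  refine ⟨φ, fun z hz => ?_, ?_⟩
  · rw [Subgroup.mem_comap, ← QuotientGroup.eq_one_iff]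
    have h1 := DFunLike.congr_fun hcomp z
    simp only [MonoidHom.comp_apply, QuotientGroup.mk'_apply] at h1
    rw [h1, (QuotientGroup.eq_one_iff z).2 hz, map_one]
  · exact QuotientGroup.monoidHom_ext _ hcomp
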